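/- Let $D,N\ge 0$ be integers, let $\mathbf p_1,\mathbf p_2,\mathbf p_3\in\mathbb R^D$ be fixed, and let $S_0=\prod_{j=1}^D[lb_j,ub_j]$ with $lb_j<ub_j$ for all $j$. For every integer $T\ge 1$ consider a run of the grey wolf optimizer with $T$ iterations and $N$ agents under the stagnation assumption, that is, with the three best positions frozen at $\mathbf p_1,\mathbf p_2,\mathbf p_3$: agent $i$ starts at a (possibly random) position $\mathbf x_i(1)$, the same for all $T$, and for $1\le t<T$ and $1\le j\le D$ $$x_{ij}(t+1)=\frac13\sum_{k=1}^3\Bigl(p_{kj}+A_{kj}\,\bigl|C_{kj}\,p_{kj}-x_{ij}(t)\bigr|\Bigr),$$ where $A_{kj}\sim U[-a,a]$ with $a=2(1-t/T)$ and $C_{kj}\sim U[0,2]$ are drawn afresh for every iteration $t$, agent $i$, leader $k$ and coordinate $j$, all of them mutually independent and independent of the initial positions $(\mathbf x_1(1),\dots,\mathbf x_N(1))$. Assume that $0\in[lb_j,ub_j]$ for every coordinate $j$ with $p_{1j}=p_{2j}=p_{3j}=0$ (in particular, there is no restriction if there is no such coordinate). Let $i$ be an agent with $\mathbf x_i(1)\ne\frac13\sum_{k=1}^3\mathbf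 p_k$ almost surely. Then the probability that agent $i$ has found $S_0$ by iteration $t$ tends to $1$ as $t\to\infty$, uniformly in the total number of iterations $T\ge t$: $$\lim_{t\to\infty}\ \inf_{T\ge t}\ \mathbb P\bigl\{\exists\, s\in\{1,\dots,t\}:\ \mathbf x_i(s)\in S_0\bigr\}=1 .$$ In particular, the probability that agent $i$ finds $S_0$ within the first $\lfloor 0.05T\rfloor$ iterations of a run of $T$ iterations tends to $1$ as $T\to\infty$. -/

import Mathlib

open MeasureTheory ProbabilityTheory Filter Topology

namespace GWO

/-- The control parameter `a = 2 (1 - t / T)` at iteration `t` of a run with `T` iterations. -/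
noncomputable def control (T t : ℕ) : ℝ := 2 * (1 - (t : ℝ) / (T : ℝ))

/-- The centre `(1/3) (p₁ + p₂ + p₃)` of the three leading positions. -/
noncomputable def center {D : ℕ} (p : Fin 3 → Fin D → ℝ) : Fin D → ℝ :=
  fun j => (1 / 3) * ∑ k, p k j

/-- One position update of a search agent at `x`, with leaders `p` and coefficients `A`, `C`:
the mean over `k` of the intermediate vectors `p_{kj} + A_{kj} |C_{kj} p_{kj} - x_j|`. -/
noncomputable def step {D : ℕ} (p A C : Fin 3 → Fin D → ℝ) (x : Fin D → ℝ) : Fin D → ℝ :=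
  fun j => (1 / 3) * ∑ k, (p k j + A k j * |C k j * p k j - x j|)

/-- `X t i` (`1 ≤ t ≤ T`) is the position at iteration `t` of agent `i` of a swarm of `N` agents
in a run of the grey wolf optimizer with `T` iterations under the stagnation assumption: the
leaders `p` do not move, the agents start at the (possibly random) positions `x₁ i`, and the
coefficients `A t i k j`, `C t i k j` used at iteration `t` are fresh independent uniform
variables on `[-a, a]` and `[0, 2]`. -/
structure IsStagnantRun {Ω : Type*} [MeasurableSpace Ω] (P : Measure Ω) {D N : ℕ}
    (T : ℕ) (p : Fin 3 → Fin D → ℝ) (x₁ : Fin N → Ω → Fin D → ℝ)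
    (A C : ℕ → Fin N → Fin 3 → Fin D → Ω → ℝ)
    (X : ℕ → Fin N → Ω → Fin D → ℝ) : Prop where
  measurable_init : ∀ i, Measurable (x₁ i)
  measurable_A : ∀ t i k j, Measurable (A t i k j)
  measurable_C : ∀ t i k j, Measurable (C t i k j)
  uniform_A : ∀ t, 1 ≤ t → t < T → ∀ i k j,
    pdf.IsUniform (A t i k j) (Set.Icc (-control T t) (control T t)) P volume
  uniform_C : ∀ t, 1 ≤ t → t < T → ∀ i k j,
    pdf.IsUniform (C t i k j) (Set.Icc 0 2) P volume
  /-- all the coefficients are mutually independent -/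
  indep_coeff : iIndepFun
    (Sum.elim (fun q : ℕ × Fin N × Fin 3 × Fin D => A q.1 q.2.1 q.2.2.1 q.2.2.2)
      (fun q : ℕ × Fin N × Fin 3 × Fin D => C q.1 q.2.1 q.2.2.1 q.2.2.2)) P
  /-- the initial swarm is independent of the coefficients -/
  indep_init : IndepFun (fun ω i => x₁ i ω)
    (fun ω => ((fun t i k j => A t i k j ω : ℕ → Fin N → Fin 3 → Fin D → ℝ),
      (fun t i k j => C t i k j ω : ℕ → Fin N → Fin 3 → Fin D → ℝ))) P
  init : ∀ i ω, X 1 i ω = x₁ i ω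
  update : ∀ t, 1 ≤ t → t < T → ∀ i ω,
    X (t + 1) i ω = step p (fun k j => A t i k j ω) (fun k j => C t i k j ω) (X t i ω)

/-- The event that the trajectory `x` has found the set `S` by iteration `t`. -/
def foundBy {Ω : Type*} {D : ℕ} (x : ℕ → Ω → Fin D → ℝ) (S : Set (Fin D → ℝ)) (t : ℕ) : Set Ω :=
  {ω | ∃ s, 1 ≤ s ∧ s ≤ t ∧ x s ω ∈ S}

/-- The filter on pairs `(T, t)` for the limit `t → ∞` subject to `t ≤ T`, uniformly in `T`. -/
def iterToInfty : Filter (ℕ × ℕ) := comap Prod.snd atTop ⊓ 𝓟 {q | q.2 ≤ q.1}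

end GWO

/-! While `4 * t ≤ T` the control parameter is at least `3/2`, so all coefficients have density at
least `1/4` on the fixed windows `[-3/2, 3/2]` and `[0, 2]`. Only this first quarter of a run is
used, which makes every bound uniform in `T`.

A coordinate with a nonzero leader can be driven off the origin (`reaches_escape`) and outward by a
factor `13/10` per iteration (`reaches_grow`), until its modulus exceeds the displacement from the
leaders' mean to the middle of the target interval; one step with `C` near `0` then lands there
(`exists_reaches_Icc`). If all leaders vanish, small `A` of the right sign suffice, because the
target contains `0`. From a bounded set the required windows have a common length, and fresh
coefficients are independent of the past, so `n` iterations hit the box with probability at least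
some `Δ > 0`, on any event of the history (`le_measure_inter_chain`).

The deviation from the centre is a mean of centred independent terms, and its second moment `u`
becomes at most `8/9 * (u + const)`. Hence the positions are tight (`exists_bound`): outside a
bounded set they have probability at most `ε`. If `f` and `f'` are the failure probabilities before
and after a block, then `f' - ε ≤ (1 - Δ) * (f - ε)` (`measureReal_compl_foundBy_le`), and iteration
over blocks finishes the proof. -/

namespace GWO

/-! ### Steering a single coordinate -/

/-- The update of a single coordinate. -/
noncomputable def coordStep (p a c : Fin 3 → ℝ) (x : ℝ) : ℝ :=
  (1 / 3) * ∑ k, (p k + a k * |c k * p k - x|)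

/-- From every point of `B` the coordinate moves into `B'` as soon as the coefficients lie in
suitable intervals of length `ℓ` inside `[-3/2, 3/2]` and `[0, 2]`. -/
def Reaches (p : Fin 3 → ℝ) (ℓ : ℝ) (B B' : Set ℝ) : Prop :=
  ∀ x ∈ B, ∃ α γ : Fin 3 → ℝ,
    (∀ k, -(3 / 2) ≤ α k ∧ α k + ℓ ≤ 3 / 2 ∧ 0 ≤ γ k ∧ γ k + ℓ ≤ 2) ∧
    ∀ a c : Fin 3 → ℝ, (∀ k, a k ∈ Set.Icc (α k) (α k + ℓ)) →
      (∀ k, c k ∈ Set.Icc (γ k) (γ k + ℓ)) → coordStep p a c x ∈ B'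

theorem Reaches.mono {p : Fin 3 → ℝ} {ℓ ℓ' : ℝ} {B B' : Set ℝ} (h : Reaches p ℓ B B')
    (hℓ : ℓ' ≤ ℓ) : Reaches p ℓ' B B' := by
  intro x hx
  obtain ⟨α, γ, h1, h2⟩ := h x hx
  refine ⟨α, γ, fun k => ?_, fun a c ha hc => h2 a c (fun k => ?_) (fun k => ?_)⟩
  · obtain ⟨u, v, w, z⟩ := h1 k
    exact ⟨u, by linarith, w, by linarith⟩
  · exact ⟨(ha k).1, by linarith [(ha k).2]⟩
  · exact ⟨(hc k).1, by linarith [(hc k).2]⟩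

/-- The symmetric annulus `r ≤ |x| ≤ K` of the real line. -/
def annulus (r K : ℝ) : Set ℝ := {x | r ≤ |x| ∧ |x| ≤ K}

theorem measurableSet_annulus (r K : ℝ) : MeasurableSet (annulus r K) :=
  (measurableSet_le measurable_const measurable_abs).inter
    (measurableSet_le measurable_abs measurable_const)

theorem abs_coordStep_le {p a c : Fin 3 → ℝ} {x : ℝ} (ha : ∀ k, |a k| ≤ 3 / 2)
    (hc : ∀ k, |c k| ≤ 2) : |coordStep p a c x| ≤ 2 * |x| + 2 * ∑ k, |p k| := by
  have key : ∀ k, |p k + a k * (|c k * p k - x|)| ≤ 4 * |p k| + 3 / 2 * |x| := by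
    intro k
    have h1 : |c k * p k - x| ≤ 2 * |p k| + |x| := by
      refine (abs_sub _ _).trans ?_
      rw [abs_mul]
      gcongr
      exact hc k
    calc |p k + a k * (|c k * p k - x|)| ≤ |p k| + |a k * (|c k * p k - x|)| := abs_add_le _ _
      _ = |p k| + |a k| * |c k * p k - x| := by rw [abs_mul, abs_abs]
      _ ≤ |p k| + 3 / 2 * (2 * |p k| + |x|) := by
          gcongr
          exact ha k
      _ = _ := by ring
  have h2 : |∑ k, (p k + a k * |c k * p k - x|)| ≤ ∑ k, (4 * |p k| + 3 / 2 * |x|) :=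
    (Finset.abs_sum_le_sum_abs _ _).trans (Finset.sum_le_sum fun k _ => key k)
  have e : ∑ k, (4 * |p k| + 3 / 2 * |x|) = 4 * ∑ k, |p k| + 3 * (3 / 2 * |x|) := by
    simp [Finset.sum_add_distrib, Finset.mul_sum]
  have h3 : 0 ≤ ∑ k, |p k| := Finset.sum_nonneg fun k _ => abs_nonneg _
  unfold coordStep
  rw [abs_mul, abs_of_pos (by norm_num : (0 : ℝ) < 1 / 3)]
  linarith [abs_nonneg x]

/-- All `a k` get one sign `σ` with `0 ≤ σ * ∑ k, p k`, so the leaders and the three increments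
never cancel. Their modulus is kept between `7/5` and `3/2`, which leaves room for `ℓ ≤ 1/10`; the
mean turns `7/5` into `7/15`. -/
theorem exists_outward {p γ δ : Fin 3 → ℝ} {ℓ x : ℝ} (hℓ : ℓ ≤ 1 / 10)
    (hγ : ∀ k, 0 ≤ γ k ∧ γ k + ℓ ≤ 2)
    (hδ : ∀ k, 0 ≤ δ k)
    (hd : ∀ k, ∀ c ∈ Set.Icc (γ k) (γ k + ℓ), δ k ≤ |c * p k - x|) :
    ∃ α γ : Fin 3 → ℝ,
    (∀ k, -(3 / 2) ≤ α k ∧ α k + ℓ ≤ 3 / 2 ∧ 0 ≤ γ k ∧ γ k + ℓ ≤ 2) ∧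
    ∀ a c : Fin 3 → ℝ, (∀ k, a k ∈ Set.Icc (α k) (α k + ℓ)) →
      (∀ k, c k ∈ Set.Icc (γ k) (γ k + ℓ)) →
      7 / 15 * ∑ k, δ k ≤ |coordStep p a c x| ∧
        |coordStep p a c x| ≤ 2 * |x| + 2 * ∑ k, |p k| := by
  obtain ⟨σ, hσ, hσp⟩ : ∃ σ : ℝ, (σ = 1 ∨ σ = -1) ∧ 0 ≤ σ * ∑ k, p k := by
    rcases le_total 0 (∑ k, p k) with h | h
    · exact ⟨1, Or.inl rfl, by linarith⟩
    · exact ⟨-1, Or.inr rfl, by linarith⟩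
  obtain ⟨α, hα1, hα2, hα3⟩ : ∃ α : ℝ, -(3 / 2) ≤ α ∧ α + ℓ ≤ 3 / 2 ∧
      ∀ a ∈ Set.Icc α (α + ℓ), 7 / 5 ≤ σ * a := by
    rcases hσ with rfl | rfl
    · exact ⟨7 / 5, by norm_num, by linarith, fun a ha => by linarith [ha.1]⟩
    · exact ⟨-(3 / 2), by norm_num, by linarith, fun a ha => by linarith [ha.2]⟩
  refine ⟨fun _ => α, γ, fun k => ⟨hα1, hα2, hγ k⟩, fun a c ha hc => ⟨?_, ?_⟩⟩
  · have h1 : ∀ k, 7 / 5 * δ k ≤ σ * (a k * |c k * p k - x|) := by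
      intro k
      rw [← mul_assoc]
      exact mul_le_mul (hα3 _ (ha k)) (hd k _ (hc k)) (hδ k)
        (by linarith [hα3 _ (ha k)])
    have h2 : 7 / 5 * ∑ k, δ k ≤ σ * ∑ k, a k * |c k * p k - x| := by
      rw [Finset.mul_sum, Finset.mul_sum]
      exact Finset.sum_le_sum fun k _ => h1 k
    have h3 : σ * coordStep p a c x ≤ |coordStep p a c x| := by
      rcases hσ with rfl | rfl
      · rw [one_mul]; exact le_abs_self _
      · rw [neg_one_mul]; exact neg_le_abs _
    refine le_trans ?_ h3
    unfold coordStep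
    rw [Finset.sum_add_distrib]
    nlinarith
  · refine abs_coordStep_le (fun k => abs_le.2 ⟨?_, ?_⟩) (fun k => abs_le.2 ⟨?_, ?_⟩)
    · linarith [(ha k).1]
    · linarith [(ha k).2]
    · linarith [(hc k).1, (hγ k).1]
    · linarith [(hc k).2, (hγ k).2]

/-- A coordinate with a nonzero leader moves away from the origin. -/
theorem reaches_escape {p : Fin 3 → ℝ} {k₀ : Fin 3} (K : ℝ) :
    Reaches p (1 / 10) (annulus 0 K)
      (annulus (|p k₀| / 5) (2 * K + 2 * ∑ k, |p k|)) := by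
  intro x hx
  obtain ⟨g, hg0, hg2, hg⟩ : ∃ g : ℝ, 0 ≤ g ∧ g + 1 / 10 ≤ 2 ∧
      ∀ c ∈ Set.Icc g (g + 1 / 10), |p k₀| / 2 ≤ |c * p k₀ - x| := by
    -- Between the windows `[0, 1/10]` and `[3/2, 8/5]` the point `c * p k₀` moves by at least `7/5
    -- * |p k₀|`, so it cannot be within `|p k₀| / 2` of `x` in both.
    by_contra! hcon
    obtain ⟨c, hc, hc'⟩ := hcon 0 le_rfl (by norm_num)
    obtain ⟨d, hd, hd'⟩ := hcon (3 / 2) (by norm_num) (by norm_num)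
    have h1 : |(d - c) * p k₀| < |p k₀| := by
      have : (d - c) * p k₀ = (d * p k₀ - x) - (c * p k₀ - x) := by ring
      rw [this]
      refine (abs_sub _ _).trans_lt ?_
      linarith
    rw [abs_mul, abs_of_pos (by linarith [hc.2, hd.1])] at h1
    nlinarith [abs_nonneg (p k₀), hc.2, hd.1]
  obtain ⟨α, γ, h1, h2⟩ := exists_outward (p := p) (x := x) (ℓ := 1 / 10)
    (γ := fun k => if k = k₀ then g else 0)
    (δ := fun k => if k = k₀ then |p k₀| / 2 else 0) le_rfl
    (fun k => by split_ifs; exacts [⟨hg0, hg2⟩, by norm_num])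
    (fun k => by split_ifs <;> positivity)
    (fun k c hc => by
      split_ifs at hc ⊢ with hk
      · subst hk; exact hg c hc
      · positivity)
  refine ⟨α, γ, h1, fun a c ha hc => ?_⟩
  obtain ⟨h3, h4⟩ := h2 a c ha hc
  rw [Finset.sum_ite_eq' Finset.univ k₀] at h3
  simp only [Finset.mem_univ, if_true] at h3
  exact ⟨by linarith [abs_nonneg (p k₀)], by linarith [hx.2]⟩

/-- A coordinate away from the origin can be pushed further away by a fixed factor. -/
theorem reaches_grow {p : Fin 3 → ℝ} {r ρ ℓ : ℝ} (K : ℝ) (hr : 0 < r) (hρ : r ≤ ρ)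
    (h0 : 0 ≤ ℓ) (h1 : ℓ ≤ 1 / 10) (hℓ : ℓ * ∑ k, |p k| ≤ r / 20) :
    Reaches p ℓ (annulus ρ K) (annulus (13 / 10 * ρ) (2 * K + 2 * ∑ k, |p k|)) := by
  intro x hx
  have hp : ∀ k, |p k| ≤ ∑ k, |p k| := fun k =>
    Finset.single_le_sum (f := fun k => |p k|) (fun _ _ => abs_nonneg _) (Finset.mem_univ k)
  -- With `c` in `[0, ℓ]` the distance drops by at most `r / 20 ≤ ρ / 20`, and `3 * 7/15 * 19/20 =
  -- 1.33` exceeds `13/10`.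
  obtain ⟨α, γ, h1, h2⟩ := exists_outward (p := p) (x := x) (ℓ := ℓ)
    (γ := fun _ => 0) (δ := fun _ => 19 / 20 * ρ) h1
    (fun k => ⟨le_rfl, by linarith⟩) (fun k => by linarith)
    (fun k c hc => by
      have h3 : |x| - |c * p k| ≤ |c * p k - x| := by
        rw [abs_sub_comm]; exact abs_sub_abs_le_abs_sub _ _
      have h4 : |c * p k| ≤ r / 20 := by
        rw [abs_mul, abs_of_nonneg hc.1]
        refine le_trans (mul_le_mul (by linarith [hc.2]) (hp k) (abs_nonneg _) h0) hℓ
      linarith [hx.1])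
  refine ⟨α, γ, h1, fun a c ha hc => ?_⟩
  obtain ⟨h3, h4⟩ := h2 a c ha hc
  simp only [Finset.sum_const, Finset.card_univ, Fintype.card_fin, nsmul_eq_mul] at h3
  push_cast at h3
  exact ⟨by linarith, by linarith [hx.2]⟩

/-- A coordinate far from the origin can jump into any given interval. -/
theorem exists_reaches_Icc {p : Fin 3 → ℝ} {ρ K lb ub : ℝ} (hlu : lb < ub) (hρ : 0 < ρ)
    (hK : 0 ≤ K) (hy : |(lb + ub) / 2 - 1 / 3 * ∑ k, p k| ≤ ρ) :
    ∃ ℓ, 0 < ℓ ∧ Reaches p ℓ (annulus ρ K) (Set.Icc lb ub) := by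
  set Q := ∑ k, |p k| with hQ
  have hQ0 : 0 ≤ Q := Finset.sum_nonneg fun k _ => abs_nonneg _
  have hp : ∀ k, |p k| ≤ Q := fun k =>
    Finset.single_le_sum (f := fun k => |p k|) (fun _ _ => abs_nonneg _) (Finset.mem_univ k)
  set y := (lb + ub) / 2 - 1 / 3 * ∑ k, p k with hyd
  have hden : 0 < K + 2 * Q + 1 := by positivity
  -- At `c = 0`, `a = y / |x|` the increment is exactly `y`, which leads to the midpoint. The cap
  -- `1/2` keeps `a` in `[-3/2, 3/2]`; the other bound keeps the error `ℓ * (Q + K) + ℓ * Q` below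
  -- half the width.
  refine ⟨min (1 / 2) ((ub - lb) / 2 / (K + 2 * Q + 1)), lt_min (by norm_num)
    (div_pos (by linarith) hden), ?_⟩
  set ℓ := min (1 / 2) ((ub - lb) / 2 / (K + 2 * Q + 1)) with hℓd
  have hℓ0 : 0 < ℓ := lt_min (by norm_num) (div_pos (by linarith) hden)
  have hℓ1 : ℓ ≤ 1 / 2 := min_le_left _ _
  have hℓ2 : ℓ * (K + 2 * Q + 1) ≤ (ub - lb) / 2 := by
    rw [← le_div_iff₀ hden]; exact min_le_right _ _
  intro x hx
  have hx0 : 0 < |x| := hρ.trans_le hx.1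
  have hα : |y / (|x|)| ≤ 1 := by
    rw [abs_div, abs_abs, div_le_one hx0]
    exact hy.trans hx.1
  obtain ⟨hα1, hα2⟩ := abs_le.1 hα
  refine ⟨fun _ => y / |x|, fun _ => 0, fun k => ⟨by linarith, by linarith, le_rfl, by linarith⟩,
    fun a c ha hc => ?_⟩
  have hk : ∀ k, |a k * |c k * p k - x| - y| ≤ (ub - lb) / 2 := by
    intro k
    have hc1 : |c k * p k| ≤ ℓ * Q := by
      rw [abs_mul, abs_of_nonneg (hc k).1]
      exact mul_le_mul (by linarith [(hc k).2]) (hp k) (abs_nonneg _) hℓ0.le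
    have hd : |(|c k * p k - x| - |x|)| ≤ ℓ * Q := by
      rw [abs_sub_comm (c k * p k) x]
      refine (abs_abs_sub_abs_le _ _).trans ?_
      rwa [sub_sub_cancel_left, abs_neg]
    have hd2 : |c k * p k - x| ≤ Q + K := by
      refine (abs_sub _ _).trans ?_
      nlinarith [hx.2]
    have e : a k * |c k * p k - x| - y
        = (a k - y / |x|) * |c k * p k - x| + y / |x| * (|c k * p k - x| - |x|) := by
      have := div_mul_cancel₀ y hx0.ne'
      linear_combination this
    rw [e]
    refine (abs_add_le _ _).trans ?_
    rw [abs_mul, abs_mul (y / |x|), abs_abs]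
    have ha1 : |a k - y / (|x|)| ≤ ℓ := abs_le.2 ⟨by linarith [(ha k).1], by linarith [(ha k).2]⟩
    have e1 := mul_le_mul ha1 hd2 (abs_nonneg _) hℓ0.le
    have e2 := mul_le_mul hα hd (abs_nonneg _) zero_le_one
    nlinarith
  have e : coordStep p a c x - (lb + ub) / 2 = 1 / 3 * ∑ k, (a k * |c k * p k - x| - y) := by
    unfold coordStep
    rw [Finset.sum_add_distrib, Finset.sum_sub_distrib]
    simp only [Finset.sum_const, Finset.card_univ, Fintype.card_fin, nsmul_eq_mul]
    push_cast
    rw [hyd]; ring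
  have h2 : |∑ k, (a k * |c k * p k - x| - y)| ≤ ∑ _k : Fin 3, (ub - lb) / 2 :=
    (Finset.abs_sum_le_sum_abs _ _).trans (Finset.sum_le_sum fun k _ => hk k)
  simp only [Finset.sum_const, Finset.card_univ, Fintype.card_fin, nsmul_eq_mul] at h2
  push_cast at h2
  obtain ⟨h3, h4⟩ := abs_le.1 h2
  exact ⟨by linarith, by linarith⟩

/-- A coordinate whose leaders all vanish can jump into an interval that contains `0`. -/
theorem exists_reaches_Icc_of_eq_zero {p : Fin 3 → ℝ} (hp : ∀ k, p k = 0) {K lb ub : ℝ}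
    (hlu : lb < ub) (hK : 0 ≤ K) (h0 : (0 : ℝ) ∈ Set.Icc lb ub) :
    ∃ ℓ, 0 < ℓ ∧ Reaches p ℓ (annulus 0 K) (Set.Icc lb ub) := by
  have hden : 0 < K + 1 := by positivity
  -- The end of the interval farther from `0` is nonzero; the coefficients `a` are taken small and
  -- of its sign.
  have hm : 0 < max ub (-lb) := by
    rcases h0.2.lt_or_eq with h | h
    · exact lt_max_of_lt_left h
    · exact lt_max_of_lt_right (by linarith)
  refine ⟨min 1 (max ub (-lb) / (K + 1)), lt_min one_pos (div_pos hm hden), ?_⟩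
  set ℓ := min 1 (max ub (-lb) / (K + 1)) with hℓd
  have hℓ0 : 0 < ℓ := lt_min one_pos (div_pos hm hden)
  have hℓ1 : ℓ ≤ 1 := min_le_left _ _
  have hℓ2 : ℓ * (K + 1) ≤ max ub (-lb) := by
    rw [← le_div_iff₀ hden]; exact min_le_right _ _
  intro x hx
  have hstep : ∀ a c, coordStep p a c x = (1 / 3 * ∑ k, a k) * |x| := by
    intro a c
    unfold coordStep
    simp only [hp, mul_zero, zero_add, zero_sub, abs_neg, ← Finset.sum_mul]
    ring
  have hxK : ℓ * |x| ≤ max ub (-lb) := by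
    nlinarith [hx.2]
  rcases le_total (-lb) ub with h | h
  · rw [max_eq_left h] at hxK
    refine ⟨fun _ => 0, fun _ => 0, fun k => ⟨by norm_num, by linarith, le_rfl, by linarith⟩,
      fun a c ha hc => ?_⟩
    rw [hstep, Fin.sum_univ_three]
    have e1 : 0 ≤ 1 / 3 * (a 0 + a 1 + a 2) := by linarith [(ha 0).1, (ha 1).1, (ha 2).1]
    have e2 : 1 / 3 * (a 0 + a 1 + a 2) ≤ ℓ := by linarith [(ha 0).2, (ha 1).2, (ha 2).2]
    exact ⟨h0.1.trans (by positivity), (mul_le_mul_of_nonneg_right e2 (abs_nonneg x)).trans hxK⟩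
  · rw [max_eq_right h] at hxK
    refine ⟨fun _ => -ℓ, fun _ => 0, fun k => ⟨by linarith, by linarith, le_rfl, by linarith⟩,
      fun a c ha hc => ?_⟩
    rw [hstep, Fin.sum_univ_three]
    have e1 : -ℓ ≤ 1 / 3 * (a 0 + a 1 + a 2) := by linarith [(ha 0).1, (ha 1).1, (ha 2).1]
    have e2 : 1 / 3 * (a 0 + a 1 + a 2) ≤ 0 := by linarith [(ha 0).2, (ha 1).2, (ha 2).2]
    have e3 := mul_le_mul_of_nonneg_right e1 (abs_nonneg x)
    exact ⟨by linarith, (mul_nonpos_of_nonpos_of_nonneg e2 (abs_nonneg x)).trans h0.2⟩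

/-- Bounds for the coordinate along a run that starts in `[-M, M]`. -/
noncomputable def outerRadius (M Q : ℝ) : ℕ → ℝ
  | 0 => M
  | l + 1 => 2 * outerRadius M Q l + 2 * Q

theorem outerRadius_nonneg {M Q : ℝ} (hM : 0 ≤ M) (hQ : 0 ≤ Q) (l : ℕ) :
    0 ≤ outerRadius M Q l := by
  induction l with
  | zero => exact hM
  | succ l ih => unfold outerRadius; positivity

/-- Lower bounds for the coordinate while it is driven away from the origin. -/
noncomputable def innerRadius (r : ℝ) : ℕ → ℝ
  | 0 => 0
  | l + 1 => (13 / 10) ^ l * r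

/-- Lets a coordinate whose leaders vanish wait while the others are driven outward. -/
theorem reaches_stay {p : Fin 3 → ℝ} (K : ℝ) :
    Reaches p 1 (annulus 0 K) (annulus 0 (2 * K + 2 * ∑ k, |p k|)) := by
  intro x hx
  refine ⟨fun _ => 0, fun _ => 0, fun k => by norm_num, fun a c ha hc => ⟨abs_nonneg _, ?_⟩⟩
  refine (abs_coordStep_le (fun k => abs_le.2 ⟨?_, ?_⟩) (fun k => abs_le.2 ⟨?_, ?_⟩)).trans
    (by linarith [hx.2])
  · linarith [(ha k).1]
  · linarith [(ha k).2]
  · linarith [(hc k).1]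
  · linarith [(hc k).2]

/-- A chain of annuli followed by a target set is a chain. -/
theorem exists_chain_of_annuli {p : Fin 3 → ℝ} {M : ℝ} {n : ℕ} {S : Set ℝ} (hS : MeasurableSet S)
    {r K : ℕ → ℝ} (hr : r 0 = 0) (hK : K 0 = M) {ℓ ℓ' : ℝ} (hℓ : 0 < ℓ) (hℓ' : 0 < ℓ')
    (hstep : ∀ l, Reaches p ℓ (annulus (r l) (K l)) (annulus (r (l + 1)) (K (l + 1))))
    (hlast : Reaches p ℓ' (annulus (r n) (K n)) S) :
    ∃ (U : ℕ → Set ℝ) (ℓ : ℝ), 0 < ℓ ∧ (∀ l, MeasurableSet (U l)) ∧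
      Set.Icc (-M) M ⊆ U 0 ∧ U (n + 1) ⊆ S ∧ ∀ l < n + 1, Reaches p ℓ (U l) (U (l + 1)) := by
  refine ⟨fun l => if l ≤ n then annulus (r l) (K l) else S, min ℓ ℓ',
    lt_min hℓ hℓ', ?_, ?_, ?_, ?_⟩
  · intro l
    dsimp only
    split_ifs
    exacts [measurableSet_annulus _ _, hS]
  · intro x hx
    simp only [zero_le, if_true, hr, hK]
    exact ⟨abs_nonneg _, abs_le.2 hx⟩
  · simp
  · intro l hl
    have hl' : l ≤ n := by omega
    rcases hl'.lt_or_eq with h | rfl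
    · simp only [hl', if_true, Nat.succ_le_iff.2 h]
      exact (hstep l).mono (min_le_left _ _)
    · simp only [le_refl, if_true, Nat.not_succ_le_self, if_false]
      exact hlast.mono (min_le_right _ _)

/-- From a bounded interval a coordinate can be driven into `[lb, ub]` in any sufficiently large
number of steps. -/
theorem exists_chain (p : Fin 3 → ℝ) {M lb ub : ℝ} (hM : 0 ≤ M) (hlu : lb < ub)
    (h0 : (∀ k, p k = 0) → (0 : ℝ) ∈ Set.Icc lb ub) :
    ∃ n₀ : ℕ, ∀ n, n₀ ≤ n → ∃ (U : ℕ → Set ℝ) (ℓ : ℝ), 0 < ℓ ∧ (∀ l, MeasurableSet (U l)) ∧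
      Set.Icc (-M) M ⊆ U 0 ∧ U (n + 1) ⊆ Set.Icc lb ub ∧
      ∀ l < n + 1, Reaches p ℓ (U l) (U (l + 1)) := by
  have hQ0 : 0 ≤ ∑ k, |p k| := Finset.sum_nonneg fun k _ => abs_nonneg _
  by_cases hp : ∀ k, p k = 0
  · refine ⟨0, fun n _ => ?_⟩
    obtain ⟨ℓ', hℓ', hlast⟩ := exists_reaches_Icc_of_eq_zero hp hlu
      (outerRadius_nonneg hM hQ0 n) (h0 hp)
    exact exists_chain_of_annuli measurableSet_Icc (r := fun _ => 0)
      (K := outerRadius M (∑ k, |p k|)) rfl rfl one_pos hℓ' (fun l => reaches_stay _) hlast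
  · push Not at hp
    obtain ⟨k₀, hk₀⟩ := hp
    set Q := ∑ k, |p k| with hQ
    set r := |p k₀| / 5 with hr
    have hr0 : 0 < r := by positivity
    obtain ⟨n₀, hn₀⟩ : ∃ n₀ : ℕ, |(lb + ub) / 2 - 1 / 3 * ∑ k, p k| / r < (13 / 10 : ℝ) ^ n₀ :=
      pow_unbounded_of_one_lt _ (by norm_num)
    -- The additional step is the escape from the origin that precedes the growth.
    refine ⟨n₀ + 1, fun n hn => ?_⟩
    obtain ⟨m, rfl⟩ : ∃ m, n = m + 1 := ⟨n - 1, by omega⟩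
    have hm : |(lb + ub) / 2 - 1 / 3 * ∑ k, p k| ≤ innerRadius r (m + 1) := by
      rw [div_lt_iff₀ hr0] at hn₀
      refine hn₀.le.trans (mul_le_mul_of_nonneg_right ?_ hr0.le)
      exact pow_le_pow_right₀ (by norm_num) (by omega)
    have hpos : ∀ l, r ≤ innerRadius r (l + 1) := fun l =>
      le_mul_of_one_le_left hr0.le (one_le_pow₀ (by norm_num))
    obtain ⟨ℓ', hℓ', hlast⟩ := exists_reaches_Icc hlu (hr0.trans_le (hpos m))
      (outerRadius_nonneg hM hQ0 (m + 1)) hm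
    have hden : 0 < Q + 1 := by positivity
    refine exists_chain_of_annuli measurableSet_Icc (r := innerRadius r)
      (K := outerRadius M Q) (ℓ := min (1 / 10) (r / 20 / (Q + 1))) rfl rfl
      (lt_min (by norm_num) (by positivity)) hℓ' (fun l => ?_) hlast
    cases l with
    | zero =>
      have := (reaches_escape (p := p) (k₀ := k₀) M).mono
        (min_le_left (1 / 10) (r / 20 / (Q + 1)))
      simpa [innerRadius, outerRadius] using this
    | succ l =>
      have h := min_le_right (1 / 10) (r / 20 / (Q + 1))
      rw [le_div_iff₀ hden] at h
      have hmin : 0 < min (1 / 10) (r / 20 / (Q + 1)) := lt_min (by norm_num) (by positivity)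
      have := reaches_grow (p := p) (outerRadius M Q (l + 1)) hr0 (hpos l) hmin.le
        (min_le_left _ _) (by nlinarith)
      have e : 13 / 10 * innerRadius r (l + 1) = innerRadius r (l + 1 + 1) := by
        simp only [innerRadius, pow_succ]; ring
      rw [e] at this
      exact this

end GWO

/-! ### Uniform variables -/

section Uniform

variable {Ω : Type*} [MeasurableSpace Ω] {P : Measure Ω} {X : Ω → ℝ} {u v : ℝ}

theorem ae_mem_Icc_of_isUniform (hX : Measurable X) (h : pdf.IsUniform X (Set.Icc u v) P volume) :
    ∀ᵐ ω ∂P, X ω ∈ Set.Icc u v := by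
  refine ae_of_ae_map hX.aemeasurable ?_
  rw [h]
  exact ae_cond_mem measurableSet_Icc

theorem integral_comp_of_isUniform (huv : u < v) (hX : Measurable X)
    (h : pdf.IsUniform X (Set.Icc u v) P volume) {f : ℝ → ℝ} (hf : Measurable f) :
    ∫ ω, f (X ω) ∂P = (v - u)⁻¹ * ∫ x in u..v, f x := by
  rw [← integral_map hX.aemeasurable hf.aestronglyMeasurable, h, ProbabilityTheory.cond,
    integral_smul_measure, Real.volume_Icc, intervalIntegral.integral_of_le huv.le,
    integral_Icc_eq_integral_Ioc, ENNReal.toReal_inv, ENNReal.toReal_ofReal (by linarith),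
    smul_eq_mul]

theorem integral_of_isUniform_symm {a : ℝ} (ha : 0 < a) (hX : Measurable X)
    (h : pdf.IsUniform X (Set.Icc (-a) a) P volume) : ∫ ω, X ω ∂P = 0 := by
  have := integral_comp_of_isUniform (by linarith) hX h measurable_id
  simpa using this

theorem integral_sq_of_isUniform_symm {a : ℝ} (ha : 0 < a) (hX : Measurable X)
    (h : pdf.IsUniform X (Set.Icc (-a) a) P volume) : ∫ ω, X ω ^ 2 ∂P = a ^ 2 / 3 := by
  rw [integral_comp_of_isUniform (f := fun x => x ^ 2) (by linarith) hX h (by fun_prop)]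
  rw [integral_pow]
  field_simp
  push_cast
  ring

/-- The density is at least `1/4`. One constant serves both `A`, since `a ≤ 2`, and `C`. -/
theorem le_measure_Icc_of_isUniform {α ℓ : ℝ} (hℓ : 0 < ℓ) (h4 : v - u ≤ 4) (hu : u ≤ α)
    (hv : α + ℓ ≤ v) (h : pdf.IsUniform X (Set.Icc u v) P volume) :
    ENNReal.ofReal (ℓ / 4) ≤ P (X ⁻¹' Set.Icc α (α + ℓ)) := by
  have huv : 0 < v - u := by linarith
  rw [h.measure_preimage (by rw [Real.volume_Icc]; simpa using huv) (by simp) measurableSet_Icc,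
    Set.inter_eq_self_of_subset_right (Set.Icc_subset_Icc hu hv), Real.volume_Icc, Real.volume_Icc,
    ← ENNReal.ofReal_div_of_pos huv]
  refine ENNReal.ofReal_le_ofReal ?_
  rw [add_sub_cancel_left]
  exact div_le_div_of_nonneg_left hℓ.le huv h4

end Uniform

/-! ### Independence and freezing -/

section Independence

variable {Ω α β γ : Type*} [MeasurableSpace Ω] [MeasurableSpace α] [MeasurableSpace β]
  [MeasurableSpace γ] {P : Measure Ω} [IsProbabilityMeasure P]

/-- The joint law is a triple product, which can be reassociated. This joins the initial position to
the past coefficients. -/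
theorem IndepFun.prodMk_left_of_prodMk_right {X : Ω → α} {Y : Ω → β} {Z : Ω → γ}
    (hX : Measurable X) (hY : Measurable Y) (hZ : Measurable Z)
    (h : IndepFun X (fun ω => (Y ω, Z ω)) P) (h' : IndepFun Y Z P) :
    IndepFun (fun ω => (X ω, Y ω)) Z P := by
  have hXY : IndepFun X Y P := h.comp measurable_id measurable_fst
  rw [indepFun_iff_map_prod_eq_prod_map_map (hX.prodMk hY).aemeasurable hZ.aemeasurable,
    hXY.map_prod_eq_prod_map_map hX.aemeasurable hY.aemeasurable]
  have e := h.map_prod_eq_prod_map_map hX.aemeasurable (hY.prodMk hZ).aemeasurable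
  rw [h'.map_prod_eq_prod_map_map hY.aemeasurable hZ.aemeasurable] at e
  have e2 : P.map (fun ω => ((X ω, Y ω), Z ω))
      = (P.map (fun ω => (X ω, (Y ω, Z ω)))).map MeasurableEquiv.prodAssoc.symm := by
    rw [Measure.map_map (MeasurableEquiv.measurable _) (hX.prodMk (hY.prodMk hZ))]
    rfl
  have := Measure.isProbabilityMeasure_map (μ := P) hX.aemeasurable
  have := Measure.isProbabilityMeasure_map (μ := P) hY.aemeasurable
  have := Measure.isProbabilityMeasure_map (μ := P) hZ.aemeasurable
  rw [e2, e, ← Measure.prodAssoc_prod, MeasurableEquiv.map_symm_map]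

/-- Tonelli for the product law; it takes the place of conditioning on the history. -/
theorem lintegral_comp_of_indepFun {X : Ω → α} {Y : Ω → β} (hX : Measurable X) (hY : Measurable Y)
    (h : IndepFun X Y P) {g : α × β → ENNReal} (hg : Measurable g) :
    ∫⁻ ω, g (X ω, Y ω) ∂P = ∫⁻ ω, ∫⁻ ω', g (X ω, Y ω') ∂P ∂P := by
  have := Measure.isProbabilityMeasure_map (μ := P) hX.aemeasurable
  have := Measure.isProbabilityMeasure_map (μ := P) hY.aemeasurable
  rw [← lintegral_map (f := g) hg (hX.prodMk hY),
    h.map_prod_eq_prod_map_map hX.aemeasurable hY.aemeasurable, lintegral_prod _ hg.aemeasurable,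
    lintegral_map hg.lintegral_prod_right' hX]
  refine lintegral_congr fun ω => ?_
  rw [lintegral_map (by fun_prop) hY]

end Independence

/-! ### Histories, one-step transition and moment bounds -/

namespace GWO

theorem control_le_two (T t : ℕ) : control T t ≤ 2 := by
  unfold control
  have : 0 ≤ (t : ℝ) / T := by positivity
  linarith

theorem control_pos {T t : ℕ} (h : t < T) : 0 < control T t := by
  unfold control
  have hT : (0 : ℝ) < T := by exact_mod_cast (Nat.zero_le t).trans_lt h
  have : (t : ℝ) / T < 1 := by
    rw [div_lt_one hT]; exact_mod_cast h
  linarith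

theorem three_halves_le_control {T t : ℕ} (h0 : 1 ≤ t) (h : 4 * t ≤ T) :
    3 / 2 ≤ control T t := by
  unfold control
  have hT : (0 : ℝ) < T := by exact_mod_cast (by omega : 0 < T)
  have : (t : ℝ) / T ≤ 1 / 4 := by
    rw [div_le_iff₀ hT]
    have : (4 * t : ℝ) ≤ T := by exact_mod_cast h
    linarith
  linarith

/-- The coefficients used in one iteration of one agent. -/
abbrev Coeff (D : ℕ) := (Fin 3 → Fin D → ℝ) × (Fin 3 → Fin D → ℝ)

theorem measurable_step {D : ℕ} (p : Fin 3 → Fin D → ℝ) :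
    Measurable fun z : Coeff D × (Fin D → ℝ) => step p z.1.1 z.1.2 z.2 := by
  unfold step
  fun_prop

/-- The position at iteration `s + 1` as a function of the initial position and the coefficients. -/
noncomputable def pos {D : ℕ} (p : Fin 3 → Fin D → ℝ) :
    ℕ → (Fin D → ℝ) × (ℕ → Coeff D) → Fin D → ℝ
  | 0, h => h.1
  | s + 1, h => step p (h.2 (s + 1)).1 (h.2 (s + 1)).2 (pos p s h)

theorem measurable_pos {D : ℕ} (p : Fin 3 → Fin D → ℝ) (s : ℕ) : Measurable (pos p s) := by
  induction s with
  | zero => exact measurable_fst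
  | succ s ih =>
    exact (measurable_step p).comp
      (((measurable_pi_apply (s + 1)).comp measurable_snd).prodMk ih)

/-- The part of a sequence of coefficients that is drawn before iteration `t`. -/
noncomputable def truncate {D : ℕ} (t : ℕ) (h : (Fin D → ℝ) × (ℕ → Coeff D)) :
    (Fin D → ℝ) × (ℕ → Coeff D) :=
  -- The default `0` for coefficients not yet drawn lets the histories of all iterations share one
  -- type.
  (h.1, fun s => if s < t then h.2 s else 0)

theorem measurable_truncate {D : ℕ} (t : ℕ) : Measurable (truncate (D := D) t) := by
  refine measurable_fst.prodMk (measurable_pi_lambda _ fun s => ?_)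
  by_cases h : s < t
  · simp only [h, if_true]; fun_prop
  · simp only [h, if_false]; fun_prop

/-- The coefficients of agent `i` at iteration `t`. -/
def coeff {Ω : Type*} {D N : ℕ} (A C : ℕ → Fin N → Fin 3 → Fin D → Ω → ℝ)
    (i : Fin N) (t : ℕ) (ω : Ω) : Coeff D :=
  (fun k j => A t i k j ω, fun k j => C t i k j ω)

/-- The history of agent `i` before the coefficients of iteration `t` are drawn. -/
noncomputable def hist {Ω : Type*} {D N : ℕ} (x₁ : Fin N → Ω → Fin D → ℝ)
    (A C : ℕ → Fin N → Fin 3 → Fin D → Ω → ℝ) (i : Fin N) (t : ℕ) (ω : Ω) :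
    (Fin D → ℝ) × (ℕ → Coeff D) :=
  truncate t (x₁ i ω, fun s => coeff A C i s ω)

/-- Turns an event of an early history into an event of every later one. -/
theorem truncate_hist {Ω : Type*} {D N : ℕ} {x₁ : Fin N → Ω → Fin D → ℝ}
    {A C : ℕ → Fin N → Fin 3 → Fin D → Ω → ℝ} (i : Fin N) {s t : ℕ} (hst : s ≤ t) (ω : Ω) :
    truncate s (hist x₁ A C i t ω) = hist x₁ A C i s ω := by
  unfold hist truncate
  refine Prod.ext rfl (funext fun r => ?_)
  by_cases h : r < s
  · simp [h, h.trans_le hst]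
  · simp [h]

section Run

variable {Ω : Type*} [MeasurableSpace Ω] {P : Measure Ω} {D N T : ℕ}
  {p : Fin 3 → Fin D → ℝ} {x₁ : Fin N → Ω → Fin D → ℝ}
  {A C : ℕ → Fin N → Fin 3 → Fin D → Ω → ℝ} {X : ℕ → Fin N → Ω → Fin D → ℝ}

namespace IsStagnantRun

theorem measurable_coeff (h : IsStagnantRun P T p x₁ A C X) (i : Fin N) (t : ℕ) :
    Measurable (coeff A C i t) := by
  have hA := h.measurable_A
  have hC := h.measurable_C
  unfold coeff
  fun_prop

theorem measurable_hist (h : IsStagnantRun P T p x₁ A C X) (i : Fin N) (t : ℕ) :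
    Measurable (hist x₁ A C i t) :=
  (measurable_truncate t).comp
    ((h.measurable_init i).prodMk (measurable_pi_lambda _ fun s => h.measurable_coeff i s))

/-- `pos p s` reads only the coefficients of iterations `1, …, s`, which survive truncation at `t >
s`. -/
theorem eq_pos (h : IsStagnantRun P T p x₁ A C X) (i : Fin N) {s t : ℕ} (hst : s < t)
    (hsT : s < T) (ω : Ω) : X (s + 1) i ω = pos p s (hist x₁ A C i t ω) := by
  induction s with
  | zero => rw [zero_add, h.init]; rfl
  | succ s ih =>
    rw [h.update (s + 1) (by omega) hsT, ih (by omega) (by omega)]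
    simp [pos, hist, truncate, hst, coeff]

theorem indepFun_hist_coeff [IsProbabilityMeasure P]
    (h : IsStagnantRun P T p x₁ A C X) (i : Fin N) (t : ℕ) :
    IndepFun (hist x₁ A C i t) (coeff A C i t) P := by
  have hmeas : ∀ q, Measurable
      (Sum.elim (fun q : ℕ × Fin N × Fin 3 × Fin D => A q.1 q.2.1 q.2.2.1 q.2.2.2)
      (fun q : ℕ × Fin N × Fin 3 × Fin D => C q.1 q.2.1 q.2.2.1 q.2.2.2) q) := by
    rintro (q | q)
    exacts [h.measurable_A _ _ _ _, h.measurable_C _ _ _ _]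
  let S : Finset (ℕ × Fin N × Fin 3 × Fin D) := Finset.range t ×ˢ Finset.univ
  let S' : Finset (ℕ × Fin N × Fin 3 × Fin D) := {t} ×ˢ Finset.univ
  have hdisj : Disjoint (S.disjSum S) (S'.disjSum S') := by
    rw [Finset.disjoint_left]
    rintro (q | q) hq hq'
    all_goals
      simp only [Finset.inl_mem_disjSum, Finset.inr_mem_disjSum, S, S', Finset.mem_product,
        Finset.mem_range, Finset.mem_singleton] at hq hq'
      omega
  have hind := h.indep_coeff.indepFun_finset _ _ hdisj hmeas
  have mS : ∀ {s : ℕ}, s < t → ∀ k j, (s, i, k, j) ∈ S := fun hs k j => by simp [S, hs]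
  have mS' : ∀ k j, (t, i, k, j) ∈ S' := fun k j => by simp [S']
  let past : Ω → ℕ → Coeff D := fun ω s => if s < t then coeff A C i s ω else 0
  let φ : (↥(S.disjSum S) → ℝ) → ℕ → Coeff D := fun v s =>
    if hs : s < t then
      (fun k j => v ⟨Sum.inl (s, i, k, j), Finset.inl_mem_disjSum.2 (mS hs k j)⟩,
        fun k j => v ⟨Sum.inr (s, i, k, j), Finset.inr_mem_disjSum.2 (mS hs k j)⟩)
    else 0
  let ψ : (↥(S'.disjSum S') → ℝ) → Coeff D := fun v =>
    (fun k j => v ⟨Sum.inl (t, i, k, j), Finset.inl_mem_disjSum.2 (mS' k j)⟩,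
      fun k j => v ⟨Sum.inr (t, i, k, j), Finset.inr_mem_disjSum.2 (mS' k j)⟩)
  have hφ : Measurable φ := by
    refine measurable_pi_lambda _ fun s => ?_
    by_cases hs : s < t
    · simp only [φ, hs, dif_pos]; fun_prop
    · simp only [φ, hs, dif_neg, not_false_eq_true]; fun_prop
  have hψ : Measurable ψ := by fun_prop
  have hpast : Measurable past := by
    refine measurable_pi_lambda _ fun s => ?_
    by_cases hs : s < t
    · simp only [past, hs, if_true]; exact h.measurable_coeff i s
    · simp only [past, hs, if_false]; fun_prop
  have h1 : IndepFun past (coeff A C i t) P := by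
    have := hind.comp hφ hψ
    have e : past = φ ∘ fun ω (q : ↥(S.disjSum S)) =>
        Sum.elim (fun q : ℕ × Fin N × Fin 3 × Fin D => A q.1 q.2.1 q.2.2.1 q.2.2.2)
        (fun q : ℕ × Fin N × Fin 3 × Fin D => C q.1 q.2.1 q.2.2.1 q.2.2.2) q ω := by
      funext ω s
      by_cases hs : s < t
      · simp [past, φ, hs, coeff]
      · simp [past, φ, hs]
    rw [e]
    exact this
  have h2 : IndepFun (x₁ i) (fun ω => (past ω, coeff A C i t ω)) P := by
    let χ : (ℕ → Fin N → Fin 3 → Fin D → ℝ) × (ℕ → Fin N → Fin 3 → Fin D → ℝ) →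
      (ℕ → Coeff D) × Coeff D := fun v =>
        ((fun s => if s < t then (v.1 s i, v.2 s i) else 0), (v.1 t i, v.2 t i))
    have hχ : Measurable χ := by
      refine Measurable.prodMk (measurable_pi_lambda _ fun s => ?_) (by fun_prop)
      by_cases hs : s < t
      · simp only [hs, if_true]; fun_prop
      · simp only [hs, if_false]; fun_prop
    exact h.indep_init.comp (measurable_pi_apply i) hχ
  exact IndepFun.prodMk_left_of_prodMk_right (h.measurable_init i) hpast (h.measurable_coeff i t)
    h2 h1

/-- If every coordinate can be pushed from `B j` to `B' j`, the agent moves from the product of the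
`B j` to the product of the `B' j` with probability bounded below. -/
theorem le_measure_step (h : IsStagnantRun P T p x₁ A C X) (i : Fin N) {t : ℕ} (ht : 1 ≤ t)
    (htT : 4 * t ≤ T) {ℓ : ℝ} (hℓ : 0 < ℓ) {B B' : Fin D → Set ℝ}
    (hB : ∀ j, Reaches (fun k => p k j) ℓ (B j) (B' j)) {x : Fin D → ℝ} (hx : ∀ j, x j ∈ B j) :
    ENNReal.ofReal (ℓ / 4) ^ Fintype.card ((Fin 3 × Fin D) ⊕ (Fin 3 × Fin D)) ≤
      P {ω | ∀ j, step p (coeff A C i t ω).1 (coeff A C i t ω).2 x j ∈ B' j} := by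
  choose α γ hαγ hstep using fun j => hB j (x j) (hx j)
  let e : (Fin 3 × Fin D) ⊕ (Fin 3 × Fin D) →
      (ℕ × Fin N × Fin 3 × Fin D) ⊕ (ℕ × Fin N × Fin 3 × Fin D) :=
    Sum.map (fun q => (t, i, q)) (fun q => (t, i, q))
  have he : Function.Injective e :=
    Function.Injective.sumMap (fun q q' hq => by simpa using hq) (fun q q' hq => by simpa using hq)
  have hind := h.indep_coeff.precomp he
  let I : (Fin 3 × Fin D) ⊕ (Fin 3 × Fin D) → Set ℝ :=
    Sum.elim (fun q => Set.Icc (α q.2 q.1) (α q.2 q.1 + ℓ))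
      (fun q => Set.Icc (γ q.2 q.1) (γ q.2 q.1 + ℓ))
  have hprod := hind.measure_inter_preimage_eq_mul Finset.univ (sets := I) (by
    rintro (q | q) -
    exacts [measurableSet_Icc, measurableSet_Icc])
  have hle : ∀ q ∈ Finset.univ, ENNReal.ofReal (ℓ / 4) ≤ P
      ((Sum.elim (fun q : ℕ × Fin N × Fin 3 × Fin D => A q.1 q.2.1 q.2.2.1 q.2.2.2)
      (fun q : ℕ × Fin N × Fin 3 × Fin D => C q.1 q.2.1 q.2.2.1 q.2.2.2) (e q)) ⁻¹' I q) := by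
    have hc := three_halves_le_control ht htT
    have hc2 := control_le_two T t
    rintro (q | q) -
    · obtain ⟨h1, h2, -, -⟩ := hαγ q.2 q.1
      exact le_measure_Icc_of_isUniform hℓ (by linarith) (by linarith) (by linarith)
        (h.uniform_A t ht (by omega) i q.1 q.2)
    · obtain ⟨-, -, h1, h2⟩ := hαγ q.2 q.1
      exact le_measure_Icc_of_isUniform hℓ (by linarith) (by linarith) (by linarith)
        (h.uniform_C t ht (by omega) i q.1 q.2)
  have hpow := Finset.prod_le_prod' hle
  rw [Finset.prod_const, Finset.card_univ] at hpow
  refine hpow.trans (hprod.symm.le.trans (measure_mono fun ω hω j => ?_))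
  simp only [Finset.mem_univ, Set.iInter_true, Set.mem_iInter] at hω
  exact hstep j _ _ (fun k => hω (Sum.inl (k, j))) (fun k => hω (Sum.inr (k, j)))

/-- A lower bound for the transition probabilities from `B` to `B'` holds on every event of the
history. -/
theorem le_measure_inter_step [IsProbabilityMeasure P]
    (h : IsStagnantRun P T p x₁ A C X) (i : Fin N) {t : ℕ}
    (htT : t + 1 < T) {δ : ENNReal} {B B' : Set (Fin D → ℝ)} (hB : MeasurableSet B)
    (hB' : MeasurableSet B')
    (hδ : ∀ x ∈ B, δ ≤ P {ω | step p (coeff A C i (t + 1) ω).1 (coeff A C i (t + 1) ω).2 x ∈ B'})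
    {E : Set ((Fin D → ℝ) × (ℕ → Coeff D))} (hE : MeasurableSet E) :
    δ * P (hist x₁ A C i (t + 1) ⁻¹' E ∩ {ω | X (t + 1) i ω ∈ B}) ≤
      P (hist x₁ A C i (t + 1) ⁻¹' E ∩ {ω | X (t + 2) i ω ∈ B'}) := by
  have hH := h.measurable_hist i (t + 1)
  have hξ := h.measurable_coeff i (t + 1)
  -- `pos p t` is the position at iteration `t + 1`, and `z.2` stands for the fresh coefficients of
  -- that same iteration.
  let G : Set (((Fin D → ℝ) × (ℕ → Coeff D)) × Coeff D) :=
    {z | z.1 ∈ E ∧ step p z.2.1 z.2.2 (pos p t z.1) ∈ B'}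
  have hG : MeasurableSet G := by
    refine (measurable_fst hE).inter ?_
    exact ((measurable_step p).comp
      (measurable_snd.prodMk ((measurable_pos p t).comp measurable_fst))) hB'
  have key := lintegral_comp_of_indepFun hH hξ (h.indepFun_hist_coeff i (t + 1))
    (g := G.indicator 1) (measurable_one.indicator hG)
  have hX1 : ∀ ω, X (t + 1) i ω = pos p t (hist x₁ A C i (t + 1) ω) :=
    h.eq_pos i (by omega) (by omega)
  have hX2 : ∀ ω, X (t + 2) i ω = step p (coeff A C i (t + 1) ω).1 (coeff A C i (t + 1) ω).2
      (pos p t (hist x₁ A C i (t + 1) ω)) := fun ω => by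
    rw [← hX1, h.update (t + 1) (by omega) htT]; rfl
  have hl : ∫⁻ ω, G.indicator 1 (hist x₁ A C i (t + 1) ω, coeff A C i (t + 1) ω) ∂P =
      P (hist x₁ A C i (t + 1) ⁻¹' E ∩ {ω | X (t + 2) i ω ∈ B'}) := by
    have hm : MeasurableSet ((fun ω => (hist x₁ A C i (t + 1) ω, coeff A C i (t + 1) ω)) ⁻¹' G) :=
      (hH.prodMk hξ) hG
    have e : hist x₁ A C i (t + 1) ⁻¹' E ∩ {ω | X (t + 2) i ω ∈ B'} =
        (fun ω => (hist x₁ A C i (t + 1) ω, coeff A C i (t + 1) ω)) ⁻¹' G := by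
      ext ω
      simp [G, hX2]
    rw [e, ← lintegral_indicator_one hm]
    rfl
  rw [← hl, key]
  have hm : MeasurableSet (hist x₁ A C i (t + 1) ⁻¹' E ∩ {ω | X (t + 1) i ω ∈ B}) := by
    refine (hH hE).inter ?_
    simp only [hX1]
    exact ((measurable_pos p t).comp hH) hB
  rw [← lintegral_indicator_const hm]
  refine lintegral_mono fun ω => ?_
  by_cases hω : ω ∈ hist x₁ A C i (t + 1) ⁻¹' E ∩ {ω | X (t + 1) i ω ∈ B}
  · rw [Set.indicator_of_mem hω]
    have hωB : X (t + 1) i ω ∈ B := hω.2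
    rw [hX1] at hωB
    refine (hδ _ hωB).trans ?_
    rw [← lintegral_indicator_one]
    · have hωE : hist x₁ A C i (t + 1) ω ∈ E := hω.1
      refine le_of_eq (lintegral_congr fun ω' => ?_)
      by_cases hs : step p (coeff A C i (t + 1) ω').1 (coeff A C i (t + 1) ω').2
          (pos p t (hist x₁ A C i (t + 1) ω)) ∈ B'
      · rw [Set.indicator_of_mem (show ω' ∈ {ω | step p (coeff A C i (t + 1) ω).1
          (coeff A C i (t + 1) ω).2 _ ∈ B'} from hs),
          Set.indicator_of_mem (show _ ∈ G from ⟨hωE, hs⟩)]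
        rfl
      · rw [Set.indicator_of_notMem (show ω' ∉ {ω | step p (coeff A C i (t + 1) ω).1
          (coeff A C i (t + 1) ω).2 _ ∈ B'} from hs),
          Set.indicator_of_notMem (show _ ∉ G from fun hz => hs hz.2)]
    · exact ((measurable_step p).comp (hξ.prodMk measurable_const)) hB'
  · rw [Set.indicator_of_notMem hω]
    exact zero_le

/-- The second moment of a coordinate about the centre contracts up to a constant. -/
theorem lintegral_sq_coordStep_le [IsProbabilityMeasure P]
    (h : IsStagnantRun P T p x₁ A C X) (i : Fin N) {t : ℕ}
    (ht : 1 ≤ t) (htT : t < T) (j : Fin D) {q : ℝ}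
    (hq : ∀ k, 2 * |p k j| + |center p j| ≤ q) (x : Fin D → ℝ) :
    ∫⁻ ω, ENNReal.ofReal
      ((step p (coeff A C i t ω).1 (coeff A C i t ω).2 x j - center p j) ^ 2) ∂P ≤
    ENNReal.ofReal (8 / 9 * ((x j - center p j) ^ 2 + q ^ 2)) := by
  set c := center p j with hc
  set a := control T t with ha
  have ha0 : 0 < a := control_pos htT
  have ha2 : a ≤ 2 := control_le_two T t
  have mA := fun k => h.measurable_A t i k j
  have mC := fun k => h.measurable_C t i k j
  have uA := fun k => h.uniform_A t ht htT i k j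
  have uC := fun k => h.uniform_C t ht htT i k j
  set d : Fin 3 → Ω → ℝ := fun k ω => |C t i k j ω * p k j - x j| with hd
  set Y : Fin 3 → Ω → ℝ := fun k ω => A t i k j ω * d k ω with hY
  have md : ∀ k, Measurable (d k) := fun k => by fun_prop
  have mY : ∀ k, Measurable (Y k) := fun k => by fun_prop
  have hmeas : ∀ q, Measurable
      (Sum.elim (fun q : ℕ × Fin N × Fin 3 × Fin D => A q.1 q.2.1 q.2.2.1 q.2.2.2)
      (fun q : ℕ × Fin N × Fin 3 × Fin D => C q.1 q.2.1 q.2.2.1 q.2.2.2) q) := by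
    rintro (q | q)
    exacts [h.measurable_A _ _ _ _, h.measurable_C _ _ _ _]
  set y := |x j - c| with hy
  have hy0 : 0 ≤ y := abs_nonneg _
  have hq0 : 0 ≤ q := le_trans (by positivity) (hq 0)
  have hdle : ∀ k, ∀ᵐ ω ∂P, d k ω ≤ y + q := by
    intro k
    filter_upwards [ae_mem_Icc_of_isUniform (mC k) (uC k)] with ω hω
    have h1 : |C t i k j ω * p k j| ≤ 2 * |p k j| := by
      rw [abs_mul, abs_of_nonneg hω.1]
      exact mul_le_mul_of_nonneg_right hω.2 (abs_nonneg _)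
    have h2 : |x j| ≤ y + |c| := by
      have := abs_add_le (x j - c) c
      rwa [sub_add_cancel] at this
    have h3 := abs_sub (C t i k j ω * p k j) (x j)
    have := hq k
    simp only [hd]
    linarith
  have hAle : ∀ k, ∀ᵐ ω ∂P, |A t i k j ω| ≤ a := by
    intro k
    filter_upwards [ae_mem_Icc_of_isUniform (mA k) (uA k)] with ω hω
    exact abs_le.2 hω
  have hd0 : ∀ k ω, 0 ≤ d k ω := fun k ω => abs_nonneg _
  have LY : ∀ k, MemLp (Y k) 2 P := by
    intro k
    refine MemLp.of_bound (mY k).aestronglyMeasurable (a * (y + q)) ?_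
    filter_upwards [hAle k, hdle k] with ω h1 h2
    rw [Real.norm_eq_abs, abs_mul, abs_of_nonneg (hd0 k ω)]
    exact mul_le_mul h1 h2 (hd0 k ω) ha0.le
  have iAC : ∀ k, IndepFun (A t i k j) (C t i k j) P := fun k =>
    h.indep_coeff.indepFun (i := Sum.inl (t, i, k, j)) (j := Sum.inr (t, i, k, j)) (by simp)
  have EY : ∀ k, ∫ ω, Y k ω ∂P = 0 := by
    intro k
    have hi : IndepFun (A t i k j) (d k) P :=
      (iAC k).comp measurable_id (by fun_prop : Measurable fun r : ℝ => |r * p k j - x j|)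
    rw [hY]
    dsimp only
    rw [hi.integral_fun_mul_eq_mul_integral (mA k).aestronglyMeasurable
      (md k).aestronglyMeasurable, integral_of_isUniform_symm ha0 (mA k) (uA k), zero_mul]
  -- The factor is the second moment `a ^ 2 / 3` of `A`, with `a ≤ 2`.
  have EY2 : ∀ k, ∫ ω, Y k ω ^ 2 ∂P ≤ 4 / 3 * (y + q) ^ 2 := by
    intro k
    have hi : IndepFun (fun ω => A t i k j ω ^ 2) (fun ω => d k ω ^ 2) P :=
      (iAC k).comp (by fun_prop : Measurable fun r : ℝ => r ^ 2)
        (by fun_prop : Measurable fun r : ℝ => |r * p k j - x j| ^ 2)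
    simp only [hY, mul_pow]
    rw [hi.integral_fun_mul_eq_mul_integral (by fun_prop) (by fun_prop),
      integral_sq_of_isUniform_symm ha0 (mA k) (uA k)]
    have h1 : ∫ ω, d k ω ^ 2 ∂P ≤ ∫ ω, (y + q) ^ 2 ∂P := by
      refine integral_mono_of_nonneg (ae_of_all _ fun ω => sq_nonneg _) (integrable_const _) ?_
      filter_upwards [hdle k] with ω hω
      exact pow_le_pow_left₀ (hd0 k ω) hω 2
    rw [integral_const, probReal_univ, one_smul] at h1
    refine mul_le_mul ?_ h1 (integral_nonneg fun ω => sq_nonneg _) (by norm_num)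
    nlinarith
  -- Different leaders use disjoint pairs of coefficients, so the `Y k` are pairwise independent.
  have hvar : Var[∑ k, Y k; P] = ∑ k, Var[Y k; P] := by
    refine IndepFun.variance_sum (fun k _ => LY k) fun k _ l _ hkl => ?_
    have := h.indep_coeff.indepFun_prodMk_prodMk hmeas (Sum.inl (t, i, k, j))
      (Sum.inr (t, i, k, j)) (Sum.inl (t, i, l, j)) (Sum.inr (t, i, l, j))
      (by simp [hkl]) (by simp) (by simp) (by simp [hkl])
    exact this.comp (by fun_prop : Measurable fun r : ℝ × ℝ => r.1 * |r.2 * p k j - x j|)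
      (by fun_prop : Measurable fun r : ℝ × ℝ => r.1 * |r.2 * p l j - x j|)
  have ES : ∫ ω, (∑ k, Y k) ω ∂P = 0 := by
    simp only [Finset.sum_apply]
    rw [integral_finsetSum _ fun k _ => (LY k).integrable (by norm_num)]
    exact Finset.sum_eq_zero fun k _ => EY k
  have LS : MemLp (∑ k, Y k) 2 P := memLp_finsetSum' _ fun k _ => LY k
  rw [variance_of_integral_eq_zero LS.aemeasurable ES] at hvar
  have hsum : ∫ ω, (∑ k, Y k) ω ^ 2 ∂P ≤ 4 * (y + q) ^ 2 := by
    rw [hvar]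
    calc ∑ k, Var[Y k; P] ≤ ∑ _k : Fin 3, 4 / 3 * (y + q) ^ 2 :=
          Finset.sum_le_sum fun k _ => by
            rw [variance_of_integral_eq_zero (mY k).aemeasurable (EY k)]; exact EY2 k
      _ = 4 * (y + q) ^ 2 := by
          simp only [Finset.sum_const, Finset.card_univ, Fintype.card_fin, nsmul_eq_mul]
          push_cast; ring
  have hst : ∀ ω, (step p (coeff A C i t ω).1 (coeff A C i t ω).2 x j - c) ^ 2
      = 1 / 9 * (∑ k, Y k) ω ^ 2 := by
    intro ω
    have : step p (coeff A C i t ω).1 (coeff A C i t ω).2 x j - c = 1 / 3 * (∑ k, Y k) ω := by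
      rw [hc]
      simp only [step, center, coeff, Finset.sum_add_distrib, Finset.sum_apply, hY, hd]
      ring
    rw [this]; ring
  simp only [hst]
  rw [← ofReal_integral_eq_lintegral_ofReal (LS.integrable_sq.const_mul _)
    (ae_of_all _ fun ω => by positivity)]
  refine ENNReal.ofReal_le_ofReal ?_
  rw [integral_const_mul]
  have : (x j - c) ^ 2 = y ^ 2 := (sq_abs _).symm
  rw [this]
  -- `4/9 * (y + q) ^ 2 ≤ 8/9 * (y ^ 2 + q ^ 2)`.
  nlinarith [sq_nonneg (y - q)]

end IsStagnantRun

end Run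

end GWO

/-! ### Second moments and tightness -/

namespace GWO

/-- The squared distance to the centre of the leaders. -/
noncomputable def sqDist {D : ℕ} (p : Fin 3 → Fin D → ℝ) (x : Fin D → ℝ) : ℝ :=
  ∑ j, (x j - center p j) ^ 2

theorem sqDist_nonneg {D : ℕ} (p : Fin 3 → Fin D → ℝ) (x : Fin D → ℝ) : 0 ≤ sqDist p x :=
  Finset.sum_nonneg fun _ _ => sq_nonneg _

theorem measurable_sqDist {D : ℕ} (p : Fin 3 → Fin D → ℝ) : Measurable (sqDist p) := by
  unfold sqDist
  fun_prop

theorem exists_measure_lt_le {Ω : Type*} [MeasurableSpace Ω] (P : Measure Ω) [IsFiniteMeasure P]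
    {f : Ω → ℝ} (hf : Measurable f) {ε : ENNReal} (hε : 0 < ε) :
    ∃ n : ℕ, P {ω | (n : ℝ) < f ω} ≤ ε := by
  have h := tendsto_measure_iInter_atTop (μ := P) (s := fun n : ℕ => {ω | (n : ℝ) < f ω})
    (fun n => (measurableSet_lt measurable_const hf).nullMeasurableSet)
    (fun m n hmn ω (hω : (n : ℝ) < f ω) => (Nat.cast_le.2 hmn).trans_lt hω)
    ⟨0, measure_ne_top _ _⟩
  have he : ⋂ n : ℕ, {ω | (n : ℝ) < f ω} = ∅ := by
    refine Set.eq_empty_of_forall_notMem fun ω hω => ?_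
    obtain ⟨n, hn⟩ := exists_nat_ge (f ω)
    have : (n : ℝ) < f ω := Set.mem_iInter.1 hω n
    linarith
  rw [he, measure_empty] at h
  exact (h.eventually_le_const hε).exists

section Run

variable {Ω : Type*} [MeasurableSpace Ω] {P : Measure Ω} {D N T : ℕ}
  {p : Fin 3 → Fin D → ℝ} {x₁ : Fin N → Ω → Fin D → ℝ}
  {A C : ℕ → Fin N → Fin 3 → Fin D → Ω → ℝ} {X : ℕ → Fin N → Ω → Fin D → ℝ}

namespace IsStagnantRun

theorem measurable_position (h : IsStagnantRun P T p x₁ A C X) (i : Fin N) {s : ℕ} (hs : s < T) :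
    Measurable (X (s + 1) i) := by
  have := (measurable_pos p s).comp (h.measurable_hist i (s + 1))
  convert this using 1
  exact funext (h.eq_pos i (by omega) hs)

theorem lintegral_sqDist_step_le [IsProbabilityMeasure P]
    (h : IsStagnantRun P T p x₁ A C X) (i : Fin N) {t : ℕ}
    (ht : 1 ≤ t) (htT : t < T) {q : ℝ} (hq : ∀ k j, 2 * |p k j| + |center p j| ≤ q)
    (x : Fin D → ℝ) :
    ∫⁻ ω, ENNReal.ofReal (sqDist p (step p (coeff A C i t ω).1 (coeff A C i t ω).2 x)) ∂P ≤
      ENNReal.ofReal (8 / 9 * (sqDist p x + D * q ^ 2)) := by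
  have hm : ∀ j, Measurable fun ω =>
      ENNReal.ofReal ((step p (coeff A C i t ω).1 (coeff A C i t ω).2 x j - center p j) ^ 2) := by
    intro j
    have := (measurable_pi_apply j).comp
      ((measurable_step p).comp ((h.measurable_coeff i t).prodMk (measurable_const (a := x))))
    exact ((this.sub_const _).pow_const 2).ennreal_ofReal
  have e : ∀ ω, ENNReal.ofReal (sqDist p (step p (coeff A C i t ω).1 (coeff A C i t ω).2 x))
      = ∑ j, ENNReal.ofReal
        ((step p (coeff A C i t ω).1 (coeff A C i t ω).2 x j - center p j) ^ 2) := fun ω =>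
    ENNReal.ofReal_sum_of_nonneg fun j _ => sq_nonneg _
  simp only [e]
  rw [lintegral_finsetSum _ fun j _ => hm j]
  have e2 : 8 / 9 * (sqDist p x + D * q ^ 2) =
      ∑ j, 8 / 9 * ((x j - center p j) ^ 2 + q ^ 2) := by
    simp [sqDist, ← Finset.mul_sum, Finset.sum_add_distrib]
  rw [e2, ENNReal.ofReal_sum_of_nonneg fun j _ => by positivity]
  exact Finset.sum_le_sum fun j _ => h.lintegral_sq_coordStep_le i ht htT j (fun k => hq k j) x

/-- The second moment about the centre, weighted by a bounded function of the initial position,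
stays bounded along a run. -/
theorem lintegral_mul_sqDist_le [IsProbabilityMeasure P]
    (h : IsStagnantRun P T p x₁ A C X) (i : Fin N) {q K : ℝ}
    (hq : ∀ k j, 2 * |p k j| + |center p j| ≤ q) (hK : 8 * (D * q ^ 2) ≤ K)
    {w : (Fin D → ℝ) → ENNReal} (hw : Measurable w) (hw1 : ∀ x, w x ≤ 1)
    (hwK : ∀ x, w x * ENNReal.ofReal (sqDist p x) ≤ ENNReal.ofReal K) {s : ℕ} (hs : s < T) :
    ∫⁻ ω, w (x₁ i ω) * ENNReal.ofReal (sqDist p (X (s + 1) i ω)) ∂P ≤ ENNReal.ofReal K := by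
  have hDq : 0 ≤ (D : ℝ) * q ^ 2 := by positivity
  induction s with
  | zero =>
    calc ∫⁻ ω, w (x₁ i ω) * ENNReal.ofReal (sqDist p (X (0 + 1) i ω)) ∂P
        ≤ ∫⁻ _, ENNReal.ofReal K ∂P := lintegral_mono fun ω => by
          rw [zero_add, h.init]; exact hwK _
      _ = ENNReal.ofReal K := by simp
  | succ s ih =>
    have hH := h.measurable_hist i (s + 1)
    have hξ := h.measurable_coeff i (s + 1)
    have hX1 : ∀ ω, X (s + 1) i ω = pos p s (hist x₁ A C i (s + 1) ω) :=
      h.eq_pos i (by omega) (by omega)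
    have mX : Measurable (X (s + 1) i) := h.measurable_position i (by omega)
    let g : ((Fin D → ℝ) × (ℕ → Coeff D)) × Coeff D → ENNReal := fun z =>
      w z.1.1 * ENNReal.ofReal (sqDist p (step p z.2.1 z.2.2 (pos p s z.1)))
    have hg : Measurable g := by
      refine (hw.comp (measurable_fst.comp measurable_fst)).mul (Measurable.ennreal_ofReal ?_)
      exact (measurable_sqDist p).comp ((measurable_step p).comp
        (measurable_snd.prodMk ((measurable_pos p s).comp measurable_fst)))
    have key := lintegral_comp_of_indepFun hH hξ (h.indepFun_hist_coeff i (s + 1)) hg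
    have e : ∀ ω, w (x₁ i ω) * ENNReal.ofReal (sqDist p (X (s + 1 + 1) i ω)) =
        g (hist x₁ A C i (s + 1) ω, coeff A C i (s + 1) ω) := fun ω => by
      rw [h.update (s + 1) (by omega) hs, hX1]; rfl
    simp only [e]
    rw [key]
    calc ∫⁻ ω, ∫⁻ ω', g (hist x₁ A C i (s + 1) ω, coeff A C i (s + 1) ω') ∂P ∂P
        ≤ ∫⁻ ω, ENNReal.ofReal (8 / 9) * (w (x₁ i ω) * ENNReal.ofReal (sqDist p (X (s + 1) i ω))
            + ENNReal.ofReal (D * q ^ 2)) ∂P := lintegral_mono fun ω => by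
          have hfst : (hist x₁ A C i (s + 1) ω).1 = x₁ i ω := rfl
          simp only [g, ← hX1, hfst]
          rw [lintegral_const_mul]
          · refine (mul_le_mul_right (h.lintegral_sqDist_step_le i (by omega) hs hq _) _).trans ?_
            rw [ENNReal.ofReal_mul (by norm_num), ENNReal.ofReal_add (sqDist_nonneg _ _) hDq,
              mul_left_comm, mul_add]
            gcongr
            exact mul_le_of_le_one_left zero_le (hw1 _)
          · exact ((measurable_sqDist p).comp ((measurable_step p).comp
              (hξ.prodMk measurable_const))).ennreal_ofReal
      _ = ENNReal.ofReal (8 / 9) * (∫⁻ ω, w (x₁ i ω) *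
            ENNReal.ofReal (sqDist p (X (s + 1) i ω)) ∂P + ENNReal.ofReal (D * q ^ 2)) := by
          have m1 : Measurable fun ω => w (x₁ i ω) * ENNReal.ofReal (sqDist p (X (s + 1) i ω)) :=
            (hw.comp (h.measurable_init i)).mul ((measurable_sqDist p).comp mX).ennreal_ofReal
          rw [lintegral_const_mul _ (m1.add_const _), lintegral_add_left m1]
          simp
      _ ≤ ENNReal.ofReal (8 / 9) * (ENNReal.ofReal K + ENNReal.ofReal (D * q ^ 2)) := by
          gcongr
          exact ih (by omega)
      _ = ENNReal.ofReal (8 / 9 * (K + D * q ^ 2)) := by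
          rw [← ENNReal.ofReal_add (by linarith) hDq, ← ENNReal.ofReal_mul (by norm_num)]
      -- `8 * (D * q ^ 2)` is the fixed point of `u ↦ 8/9 * (u + D * q ^ 2)`, so any larger bound
      -- `K` is preserved.
      _ ≤ ENNReal.ofReal K := ENNReal.ofReal_le_ofReal (by linarith)

end IsStagnantRun

/-- The positions of an agent are tight, uniformly over all iterations of all runs. -/
theorem exists_bound [IsProbabilityMeasure P] (p : Fin 3 → Fin D → ℝ)
    {i : Fin N} (hx₁ : Measurable (x₁ i)) {ε : ℝ}
    (hε : 0 < ε) :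
    ∃ M : ℝ, 0 ≤ M ∧ ∀ (T : ℕ) (A C : ℕ → Fin N → Fin 3 → Fin D → Ω → ℝ)
      (X : ℕ → Fin N → Ω → Fin D → ℝ), IsStagnantRun P T p x₁ A C X → ∀ s < T,
      P.real {ω | ¬ ∀ j, X (s + 1) i ω j ∈ Set.Icc (-M) M} ≤ ε := by
  -- The initial position need not have a second moment: it is cut off at `R` at cost `ε / 2`, and
  -- Markov's inequality at level `L = 2 * K / ε` costs the other half. No constant depends on the
  -- run.
  obtain ⟨R, hR⟩ := exists_measure_lt_le P ((measurable_sqDist p).comp hx₁)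
    (ε := ENNReal.ofReal (ε / 2)) (by simpa using hε)
  set q : ℝ := 2 * ∑ k, ∑ j, |p k j| + ∑ j, |center p j| with hqd
  have hq : ∀ k j, 2 * |p k j| + |center p j| ≤ q := by
    intro k j
    have h1 : |p k j| ≤ ∑ j, |p k j| :=
      Finset.single_le_sum (f := fun j => |p k j|) (fun _ _ => abs_nonneg _) (Finset.mem_univ j)
    have h2 : ∑ j, |p k j| ≤ ∑ k, ∑ j, |p k j| :=
      Finset.single_le_sum (f := fun k => ∑ j, |p k j|)
        (fun _ _ => Finset.sum_nonneg fun _ _ => abs_nonneg _) (Finset.mem_univ k)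
    have h3 : |center p j| ≤ ∑ j, |center p j| :=
      Finset.single_le_sum (f := fun j => |center p j|) (fun _ _ => abs_nonneg _)
        (Finset.mem_univ j)
    linarith
  set K : ℝ := R + 8 * (D * q ^ 2) + 1 with hKd
  have hDq : 0 ≤ (D : ℝ) * q ^ 2 := by positivity
  have hR0 : (0 : ℝ) ≤ R := Nat.cast_nonneg R
  have hK0 : 0 < K := by positivity
  set L : ℝ := 2 * K / ε with hLd
  have hL0 : 0 < L := by positivity
  have hc0 : 0 ≤ ∑ j, |center p j| := Finset.sum_nonneg fun _ _ => abs_nonneg _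
  refine ⟨∑ j, |center p j| + L + 1, by positivity, fun T A C X h s hs => ?_⟩
  let w : (Fin D → ℝ) → ENNReal := {x | sqDist p x ≤ R}.indicator 1
  have hwm : MeasurableSet {x | sqDist p x ≤ R} :=
    measurableSet_le (measurable_sqDist p) measurable_const
  have hw : Measurable w := measurable_one.indicator hwm
  have hint := h.lintegral_mul_sqDist_le i hq (K := K) (by linarith) hw
    (fun x => Set.indicator_le_self' (fun _ _ => zero_le) x)
    (fun x => by
      by_cases hx : sqDist p x ≤ R
      · rw [show w x = 1 from Set.indicator_of_mem (s := {x | sqDist p x ≤ R}) hx _, one_mul]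
        exact ENNReal.ofReal_le_ofReal (by linarith)
      · rw [show w x = 0 from Set.indicator_of_notMem (s := {x | sqDist p x ≤ R}) hx _, zero_mul]
        exact zero_le) hs
  have mX : Measurable (X (s + 1) i) := h.measurable_position i hs
  have m1 : Measurable fun ω => w (x₁ i ω) * ENNReal.ofReal (sqDist p (X (s + 1) i ω)) :=
    (hw.comp hx₁).mul ((measurable_sqDist p).comp mX).ennreal_ofReal
  have hmarkov := (mul_meas_ge_le_lintegral (μ := P) m1 (ENNReal.ofReal L)).trans hint
  have hL : P {ω | ENNReal.ofReal L ≤ w (x₁ i ω) * ENNReal.ofReal (sqDist p (X (s + 1) i ω))} ≤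
      ENNReal.ofReal (ε / 2) := by
    have e : ENNReal.ofReal (ε / 2) = ENNReal.ofReal K / ENNReal.ofReal L := by
      rw [← ENNReal.ofReal_div_of_pos hL0]
      congr 1
      rw [hLd]; field_simp
    rw [e, ENNReal.le_div_iff_mul_le (by simp [hL0]) (by simp), mul_comm]
    exact hmarkov
  have hsub : {ω | ¬ ∀ j, X (s + 1) i ω j ∈ Set.Icc (-(∑ j, |center p j| + L + 1))
      (∑ j, |center p j| + L + 1)} ⊆
      {ω | (R : ℝ) < sqDist p (x₁ i ω)} ∪
      {ω | ENNReal.ofReal L ≤ w (x₁ i ω) * ENNReal.ofReal (sqDist p (X (s + 1) i ω))} := by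
    intro ω hω
    by_contra hcon
    simp only [Set.mem_union, Set.mem_ofPred_eq, not_or, not_lt, not_le] at hcon
    obtain ⟨h1, h2⟩ := hcon
    rw [show w (x₁ i ω) = 1 from Set.indicator_of_mem (s := {x | sqDist p x ≤ R}) h1 _, one_mul,
      ENNReal.ofReal_lt_ofReal_iff hL0] at h2
    refine hω fun j => abs_le.1 ?_
    have h3 : (X (s + 1) i ω j - center p j) ^ 2 ≤ sqDist p (X (s + 1) i ω) :=
      Finset.single_le_sum (f := fun j => (X (s + 1) i ω j - center p j) ^ 2)
        (fun _ _ => sq_nonneg _) (Finset.mem_univ j)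
    have h4 : |X (s + 1) i ω j - center p j| ≤ L + 1 :=
      abs_le_of_sq_le_sq (by nlinarith) (by positivity)
    have h5 : |center p j| ≤ ∑ j, |center p j| :=
      Finset.single_le_sum (f := fun j => |center p j|) (fun _ _ => abs_nonneg _)
        (Finset.mem_univ j)
    have h6 := abs_add_le (X (s + 1) i ω j - center p j) (center p j)
    rw [sub_add_cancel] at h6
    linarith
  refine ENNReal.toReal_le_of_le_ofReal hε.le ?_
  refine (measure_mono hsub).trans ((measure_union_le _ _).trans ?_)
  refine (add_le_add hR hL).trans ?_
  rw [← ENNReal.ofReal_add (by positivity) (by positivity), add_halves]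

/-! ### Contraction of the failure probability over a block -/

namespace IsStagnantRun

/-- If every coordinate can be pushed along `U 0, …, U n`, then from the product of the `U 0 j` the
agent reaches the product of the `U n j` with probability bounded below. -/
theorem le_measure_inter_chain [IsProbabilityMeasure P]
    (h : IsStagnantRun P T p x₁ A C X) (i : Fin N) {t n : ℕ}
    (htT : 4 * (t + n + 1) ≤ T) {ℓ : ℝ} (hℓ : 0 < ℓ) {U : ℕ → Fin D → Set ℝ}
    (hUm : ∀ l j, MeasurableSet (U l j))
    (hU : ∀ l < n, ∀ j, Reaches (fun k => p k j) ℓ (U l j) (U (l + 1) j))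
    {E : Set ((Fin D → ℝ) × (ℕ → Coeff D))} (hE : MeasurableSet E) {l : ℕ} (hl : l ≤ n) :
    (ENNReal.ofReal (ℓ / 4) ^ Fintype.card ((Fin 3 × Fin D) ⊕ (Fin 3 × Fin D))) ^ l *
      P (hist x₁ A C i (t + 1) ⁻¹' E ∩ {ω | X (t + 1) i ω ∈ Set.univ.pi (U 0)}) ≤
    P (hist x₁ A C i (t + 1) ⁻¹' E ∩ {ω | X (t + l + 1) i ω ∈ Set.univ.pi (U l)}) := by
  induction l with
  | zero => simp
  | succ l ih =>
    have hpre : hist x₁ A C i (t + 1) ⁻¹' E =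
        hist x₁ A C i (t + l + 1) ⁻¹' (truncate (t + 1) ⁻¹' E) := by
      ext ω
      rw [Set.mem_preimage, Set.mem_preimage, Set.mem_preimage, truncate_hist i (by omega)]
    have := h.le_measure_inter_step i (t := t + l) (by omega)
      (B := Set.univ.pi (U l)) (B' := Set.univ.pi (U (l + 1)))
      (.univ_pi fun j => hUm l j) (.univ_pi fun j => hUm (l + 1) j)
      (fun x hx => by
        have := h.le_measure_step i (t := t + l + 1) (by omega) (by omega) hℓ
          (hU l (by omega)) (fun j => hx j (Set.mem_univ j))
        refine this.trans (measure_mono fun ω hω j _ => hω j))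
      (measurable_truncate (t + 1) hE)
    rw [← hpre] at this
    refine le_trans ?_ this
    rw [pow_succ', mul_assoc]
    exact mul_le_mul_right (ih (by omega)) _

/-- Failure up to iteration `t + 1` is decided before that iteration's coefficients are drawn, so
`le_measure_inter_chain` applies to it. -/
theorem compl_foundBy_eq (h : IsStagnantRun P T p x₁ A C X) (i : Fin N) {t : ℕ} (ht : t < T)
    (S : Set (Fin D → ℝ)) :
    (foundBy (fun s => X s i) S (t + 1))ᶜ =
      hist x₁ A C i (t + 1) ⁻¹' (⋂ s ∈ Finset.range (t + 1), pos p s ⁻¹' Sᶜ) := by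
  ext ω
  simp only [foundBy, Set.mem_compl_iff, Set.mem_ofPred_eq, Set.mem_preimage, Set.mem_iInter,
    Finset.mem_range, not_exists, not_and]
  constructor
  · intro hω s hs
    rw [← h.eq_pos i hs (by omega)]
    exact hω (s + 1) (by omega) (by omega)
  · intro hω s hs hst
    obtain ⟨s, rfl⟩ : ∃ r, s = r + 1 := ⟨s - 1, by omega⟩
    rw [h.eq_pos i (t := t + 1) (by omega) (by omega)]
    exact hω s (by omega)

theorem measurableSet_foundBy (h : IsStagnantRun P T p x₁ A C X) (i : Fin N) {t : ℕ} (ht : t < T)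
    {S : Set (Fin D → ℝ)} (hS : MeasurableSet S) :
    MeasurableSet (foundBy (fun s => X s i) S (t + 1)) := by
  rw [← MeasurableSet.compl_iff, h.compl_foundBy_eq i ht]
  exact h.measurable_hist i (t + 1)
    (.biInter (Finset.countable_toSet _) fun s _ => measurable_pos p s hS.compl)

/-- The probability of not having found the target contracts over a block of iterations, up to the
probability of having left a bounded region. -/
theorem measureReal_compl_foundBy_le [IsProbabilityMeasure P]
    (h : IsStagnantRun P T p x₁ A C X) (i : Fin N) {t n : ℕ}
    (hn : 0 < n) (htT : 4 * (t + n + 1) ≤ T) {ℓ : ℝ} (hℓ : 0 < ℓ) {U : ℕ → Fin D → Set ℝ}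
    (hUm : ∀ l j, MeasurableSet (U l j))
    (hU : ∀ l < n, ∀ j, Reaches (fun k => p k j) ℓ (U l j) (U (l + 1) j))
    {S : Set (Fin D → ℝ)} (hS : MeasurableSet S) (hUS : Set.univ.pi (U n) ⊆ S)
    {M ε Δ : ℝ} (hM : ∀ j, Set.Icc (-M) M ⊆ U 0 j)
    (hε : P.real {ω | ¬ ∀ j, X (t + 1) i ω j ∈ Set.Icc (-M) M} ≤ ε)
    (hΔ : Δ = ((ℓ / 4) ^ Fintype.card ((Fin 3 × Fin D) ⊕ (Fin 3 × Fin D))) ^ n) :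
    P.real (foundBy (fun s => X s i) S (t + n + 1))ᶜ - ε ≤
      (1 - Δ) * (P.real (foundBy (fun s => X s i) S (t + 1))ᶜ - ε) := by
  set NF := (foundBy (fun s => X s i) S (t + 1))ᶜ with hNF
  have hE : MeasurableSet (⋂ s ∈ Finset.range (t + 1), pos p s ⁻¹' Sᶜ) :=
    .biInter (Finset.countable_toSet _) fun s _ => measurable_pos p s hS.compl
  have hchain := h.le_measure_inter_chain i htT hℓ hUm hU hE le_rfl
  rw [← h.compl_foundBy_eq i (by omega), ← hNF] at hchain
  have hΔ0 : 0 < Δ := by rw [hΔ]; positivity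
  have hreal := ENNReal.toReal_mono (measure_ne_top _ _) hchain
  rw [ENNReal.toReal_mul, ← ENNReal.ofReal_pow (by positivity),
    ← ENNReal.ofReal_pow (by positivity),
    ← hΔ, ENNReal.toReal_ofReal hΔ0.le] at hreal
  change Δ * P.real _ ≤ P.real _ at hreal
  have h1 : P.real NF ≤ P.real (NF ∩ {ω | X (t + 1) i ω ∈ Set.univ.pi (U 0)}) + ε := by
    refine le_trans (measureReal_mono (fun ω hω => ?_)) ((measureReal_union_le _ _).trans
      (add_le_add_right hε _))
    by_cases hω' : ∀ j, X (t + 1) i ω j ∈ Set.Icc (-M) M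
    · exact Or.inl ⟨hω, fun j _ => hM j (hω' j)⟩
    · exact Or.inr hω'
  -- Continued failure, and failure so far followed by a hit at the end of the block, are disjoint
  -- parts of `NF`.
  have h2 : P.real (foundBy (fun s => X s i) S (t + n + 1))ᶜ +
      P.real (NF ∩ {ω | X (t + n + 1) i ω ∈ Set.univ.pi (U n)}) ≤ P.real NF := by
    rw [← measureReal_union]
    · refine measureReal_mono (Set.union_subset ?_ Set.inter_subset_left)
      exact Set.compl_subset_compl.2 fun ω ⟨s, a, b, c⟩ => ⟨s, a, by omega, c⟩
    · rw [Set.disjoint_left]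
      intro ω hω hω'
      exact hω ⟨t + n + 1, by omega, le_rfl, hUS hω'.2⟩
    · exact (h.measurableSet_foundBy i (by omega) hS).compl.inter
        (h.measurable_position i (by omega) (.univ_pi fun j => hUm n j))
  nlinarith

end IsStagnantRun

end Run

/-- A common length and a common number of steps for the chains of all coordinates. -/
theorem exists_common_chain {D : ℕ} (p : Fin 3 → Fin D → ℝ) {lb ub : Fin D → ℝ}
    (hbox : ∀ j, lb j < ub j) (hdeg : ∀ j, (∀ k, p k j = 0) → 0 ∈ Set.Icc (lb j) (ub j))
    {M : ℝ} (hM : 0 ≤ M) :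
    ∃ (n : ℕ) (U : ℕ → Fin D → Set ℝ) (ℓ : ℝ), 0 < n ∧ 0 < ℓ ∧ ℓ ≤ 1 ∧
      (∀ l j, MeasurableSet (U l j)) ∧ (∀ j, Set.Icc (-M) M ⊆ U 0 j) ∧
      Set.univ.pi (U n) ⊆ Set.Icc lb ub ∧
      ∀ l < n, ∀ j, Reaches (fun k => p k j) ℓ (U l j) (U (l + 1) j) := by
  -- All coordinates must arrive at the same iteration, hence the need for chains of every
  -- sufficiently large length.
  choose n₀ hn₀ using fun j => exists_chain (fun k => p k j) hM (hbox j) (hdeg j)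
  choose U ℓ hℓ hUm hM' hlast hU using fun j =>
    hn₀ j (Finset.univ.sup n₀) (Finset.le_sup (Finset.mem_univ j))
  have hev : ∀ᶠ r in 𝓝[>] (0 : ℝ), (0 < r ∧ r ≤ 1) ∧ ∀ j, r ≤ ℓ j := by
    refine (Eventually.and eventually_mem_nhdsWithin ?_).and (eventually_all.2 fun j => ?_)
    · exact nhdsWithin_le_nhds (eventually_le_nhds one_pos)
    · exact nhdsWithin_le_nhds (eventually_le_nhds (hℓ j))
  obtain ⟨r, ⟨hr0, hr1⟩, hr⟩ := hev.exists
  refine ⟨Finset.univ.sup n₀ + 1, fun l j => U j l, r, by omega, hr0, hr1, fun l j => hUm j l, hM',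
    fun x hx => ⟨fun j => (hlast j (hx j (Set.mem_univ j))).1,
      fun j => (hlast j (hx j (Set.mem_univ j))).2⟩, fun l hl j => (hU j l hl).mono (hr j)⟩

end GWO

/-! ### The theorem -/

theorem proposition2 {Ω : Type*} [MeasurableSpace Ω] (P : Measure Ω) [IsProbabilityMeasure P]
    {D N : ℕ} (p : Fin 3 → Fin D → ℝ)
    (lb ub : Fin D → ℝ) (hbox : ∀ j, lb j < ub j)
    (hdeg : ∀ j, (∀ k, p k j = 0) → 0 ∈ Set.Icc (lb j) (ub j))
    (x₁ : Fin N → Ω → Fin D → ℝ) (i : Fin N) (hx₁ : ∀ᵐ ω ∂P, x₁ i ω ≠ GWO.center p)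
    (A C : ℕ → ℕ → Fin N → Fin 3 → Fin D → Ω → ℝ)
    (X : ℕ → ℕ → Fin N → Ω → Fin D → ℝ)
    (hX : ∀ T, GWO.IsStagnantRun P T p x₁ (A T) (C T) (X T)) :
    Tendsto (fun q : ℕ × ℕ => P.real (GWO.foundBy (fun s => X q.1 s i) (Set.Icc lb ub) q.2))
      GWO.iterToInfty (𝓝 1) := by
  rw [Metric.tendsto_nhds]
  intro ε hε
  obtain ⟨M, hM0, hM⟩ := GWO.exists_bound (P := P) p ((hX 0).measurable_init i)
    (ε := ε / 3) (by positivity)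
  obtain ⟨n, U, ℓ, hn, hℓ, hℓ1, hUm, hU0, hUn, hU⟩ := GWO.exists_common_chain p hbox hdeg hM0
  obtain ⟨Δ, hΔ⟩ : ∃ Δ : ℝ,
    Δ = ((ℓ / 4) ^ Fintype.card ((Fin 3 × Fin D) ⊕ (Fin 3 × Fin D))) ^ n := ⟨_, rfl⟩
  have hΔ0 : 0 < Δ := by rw [hΔ]; positivity
  have hΔ1 : Δ ≤ 1 := by
    rw [hΔ]
    exact pow_le_one₀ (by positivity) (pow_le_one₀ (by positivity) (by linarith))
  -- After `m` blocks the failure probability is below `ε / 3 + ε / 3`. Neither `m` nor `n` depends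
  -- on `T`.
  obtain ⟨m, hm⟩ := exists_pow_lt_of_lt_one (by positivity : 0 < ε / 3) (by linarith : 1 - Δ < 1)
  have hblock : ∀ T k, 4 * (k * n + 1) ≤ T →
      P.real (GWO.foundBy (fun s => X T s i) (Set.Icc lb ub) (k * n + 1))ᶜ - ε / 3 ≤
        (1 - Δ) ^ k := by
    intro T k
    induction k with
    | zero =>
      intro _
      rw [pow_zero]
      have := measureReal_le_one (μ := P)
        (s := (GWO.foundBy (fun s => X T s i) (Set.Icc lb ub) (0 * n + 1))ᶜ)
      linarith
    | succ k ih =>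
      intro hT
      have hT' : 4 * (k * n + n + 1) ≤ T := by rw [← Nat.succ_mul]; exact hT
      have := (hX T).measureReal_compl_foundBy_le i hn hT' hℓ hUm hU measurableSet_Icc hUn hU0
        (hM T _ _ _ (hX T) (k * n) (by omega)) hΔ
      rw [Nat.succ_mul, pow_succ']
      exact this.trans (mul_le_mul_of_nonneg_left (ih (by omega)) (by linarith))
  -- Since the run is at least as long as `q.2`, the `m` blocks then fit into its first quarter.
  have hev : ∀ᶠ q in GWO.iterToInfty, 4 * (m * n + 1) ≤ q.2 ∧ q.2 ≤ q.1 := by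
    refine Eventually.and ?_ ?_
    · exact (tendsto_comap.mono_left inf_le_left).eventually (eventually_ge_atTop _)
    · exact mem_inf_of_right (mem_principal_self _)
  filter_upwards [hev] with q hq
  have h1 := hblock q.1 m (hq.1.trans hq.2)
  rw [probReal_compl_eq_one_sub ((hX q.1).measurableSet_foundBy i (by omega) measurableSet_Icc)]
    at h1
  have h2 : P.real (GWO.foundBy (fun s => X q.1 s i) (Set.Icc lb ub) (m * n + 1)) ≤
      P.real (GWO.foundBy (fun s => X q.1 s i) (Set.Icc lb ub) q.2) :=
    measureReal_mono fun ω ⟨s, a, b, c⟩ => ⟨s, a, by omega, c⟩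
  have h3 := measureReal_le_one (μ := P)
    (s := GWO.foundBy (fun s => X q.1 s i) (Set.Icc lb ub) q.2)
  rw [Real.dist_eq, abs_lt]
  constructor <;> linarith
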